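/- Let $N\ge 2$. On $L^2(\mathbb R)$ put $(T\xi)(x)=\xi(x-1)$, $(U_N\xi)(x)=N^{-1/2}\xi(x/N)$ and $\hat\xi(t)=(2\pi)^{-1/2}\int_{\mathbb R}e^{-itx}\xi(x)\,dx$ (extended to a unitary). Write $L^2(\mathbb T)=L^2(\mathbb R/2\pi\mathbb Z)$ with normalized Haar measure, with $t\in\mathbb R/2\pi\mathbb Z$ corresponding to $z=e^{-it}\in\mathbb T$. Let $\varphi\in L^2(\mathbb R)$ be a father function in scale $N$: $\{T^k\varphi\}_{k\in\mathbb Z}$ is orthonormal and, with $\mathcal V_0=\overline{\operatorname{span}}\{T^k\varphi: k\in\mathbb Z\}$ and $\mathcal V_n=U_N^n\mathcal V_0$, one has $U_N\varphi\in\mathcal V_0$, $\bigcap_{n\in\mathbb Z}\mathcal V_n=\{0\}$ and $\bigcup_{n\in\mathbb Z}\mathcal V_n$ spans a dense subspace of $L^2(\mathbb R)$. Let $\psi_1,\dots,\psi_{N-1}\in L^2(\mathbb R)$ be mother functions for $\varphi$: $\{T^k\psi_i: k\in\mathbb Z,\ 1\le i\le N-1\}$ is an orthonormal basis of $\mathcal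 V_0^\perp\cap\mathcal V_{-1}$. For $\eta\in\mathcal V_{-1}$ let $m_\eta(t)=\sum_{k}\langle T^k\varphi,U_N\eta\rangle e^{-ikt}$ in $L^2(\mathbb T)$, and put $m_0=m_\varphi$ and $m_i=m_{\psi_i}$ for $1\le i\le N-1$. Then the functions $m_0,\dots,m_{N-1}$ are essentially bounded, so that $(S_if)(t)=m_i(t)f(Nt)$, that is $(S_if)(z)=m_i(z)f(z^N)$, defines bounded operators on $L^2(\mathbb T)$; the family $\{U_N^jT^k\psi_i\}$ ($1\le i\le N-1$, $j,k\in\mathbb Z$) is orthonormal, and every $\xi\in L^2(\mathbb R)$ has the decomposition $$\xi=\sum_{i=1}^{N-1}\sum_{j,k\in\mathbb Z}a^{(i)}_{jk}(\xi)\,U_N^jT^k\psi_i,\qquad a^{(i)}_{jk}(\xi)=\langle U_N^jT^k\psi_i,\xi\rangle ,$$ where $\langle\cdot,\cdot\rangle$ is linear in the second variable. Moreover $\xi\in\mathcal V_0$ if and only if $a^{(i)}_{jk}(\xi)=0$ for all $i$, $k$ and all $j\le 0$. If $\xi\in\mathcal V_0$, there is a unique $f\in L^2(\mathbb T)$ with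 $\hat\xi(t)=f(t)\hat\varphi(t)$ for almost every $t\in\mathbb R$, and $$a^{(i)}_{jk}(\xi)=\bigl(S_i^*S_0^{*\,j-1}f\bigr)^{\sim}(k)\qquad(i=1,\dots,N-1,\ j=1,2,\dots,\ k\in\mathbb Z),$$ where $\tilde g(k)=\frac1{2\pi}\int_{-\pi}^{\pi}e^{ikt}g(t)\,dt$ is the Fourier coefficient of $g\in L^2(\mathbb T)$ at $z^k=e^{-ikt}$. -/

import Mathlib

open MeasureTheory AddCircle
open scoped ENNReal Real InnerProductSpace FourierTransform

noncomputable section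

namespace ScaleWavelet

/-- The Hilbert space `L²(ℝ)`. -/
abbrev L2R : Type := Lp ℂ 2 (volume : Measure ℝ)

instance factTwoPiPos : Fact (0 < 2 * π) := ⟨Real.two_pi_pos⟩

/-- The Hilbert space `L²(𝕋) = L²(ℝ / 2πℤ)`, with respect to normalized Haar measure. -/
abbrev L2T : Type := Lp ℂ 2 (haarAddCircle : Measure (AddCircle (2 * π)))

/-! ### Translation and scaling on the line -/

theorem measurePreserving_sub (a : ℝ) :
    MeasurePreserving (fun x : ℝ => x - a) volume volume :=
  measurePreserving_sub_right volume a

/-- The unitary `(T ξ)(x) = ξ(x - 1)` on `L²(ℝ)`. -/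
def translation : L2R ≃ₗᵢ[ℂ] L2R :=
  LinearIsometryEquiv.ofSurjective
    (Lp.compMeasurePreservingₗᵢ ℂ (fun x : ℝ => x - 1) (measurePreserving_sub 1)) (by
      intro ξ
      refine ⟨Lp.compMeasurePreserving (fun x : ℝ => x - (-1)) (measurePreserving_sub (-1)) ξ, ?_⟩
      change Lp.compMeasurePreserving _ (measurePreserving_sub 1) _ = _
      apply Lp.ext
      refine (Lp.coeFn_compMeasurePreserving _ _).trans ?_
      refine ((measurePreserving_sub 1).quasiMeasurePreserving.ae_eq_comp
        (Lp.coeFn_compMeasurePreserving ξ (measurePreserving_sub (-1)))).trans ?_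
      exact Filter.Eventually.of_forall fun x => by simp [Function.comp])

theorem translation_ae (ξ : L2R) : translation ξ =ᵐ[volume] fun x => ξ (x - 1) :=
  Lp.coeFn_compMeasurePreserving ξ (measurePreserving_sub 1)

theorem measurePreserving_div {c : ℝ} (hc : 0 < c) :
    MeasurePreserving (fun x : ℝ => x / c) volume (ENNReal.ofReal c • volume) := by
  refine ⟨by fun_prop, ?_⟩
  have h := Real.map_volume_mul_right (a := c⁻¹) (inv_ne_zero hc.ne')
  simpa [div_eq_mul_inv, abs_of_pos hc] using h

theorem memLp_dilate {c : ℝ} (hc : 0 < c) (ξ : L2R) :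
    MemLp (fun x : ℝ => ((√c)⁻¹ : ℂ) * ξ (x / c)) 2 volume :=
  ((((Lp.memLp ξ).smul_measure ENNReal.ofReal_ne_top).comp_measurePreserving
    (measurePreserving_div hc))).const_mul _

theorem dilate_aux {c : ℝ} (hc : 0 < c) {f g : ℝ → ℂ} (h : f =ᵐ[volume] g) :
    (fun x => f (x / c)) =ᵐ[volume] fun x => g (x / c) :=
  (measurePreserving_div hc).quasiMeasurePreserving.ae_eq_comp
    (Measure.smul_absolutelyContinuous.ae_eq h)

/-- The isometry `ξ ↦ c^{-1/2} ξ(· / c)` of `L²(ℝ)`, for `c > 0`. -/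
def dilationIsometry (c : ℝ) (hc : 0 < c) : L2R →ₗᵢ[ℂ] L2R where
  toFun ξ := (memLp_dilate hc ξ).toLp _
  map_add' ξ η := by
    apply Lp.ext
    filter_upwards [(memLp_dilate hc (ξ + η)).coeFn_toLp, (memLp_dilate hc ξ).coeFn_toLp,
      (memLp_dilate hc η).coeFn_toLp, dilate_aux hc (Lp.coeFn_add ξ η),
      Lp.coeFn_add ((memLp_dilate hc ξ).toLp _) ((memLp_dilate hc η).toLp _)] with x h1 h2 h3 h4 h5
    rw [h1, h5, Pi.add_apply, h2, h3, h4, Pi.add_apply, mul_add]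
  map_smul' a ξ := by
    apply Lp.ext
    filter_upwards [(memLp_dilate hc (a • ξ)).coeFn_toLp, (memLp_dilate hc ξ).coeFn_toLp,
      dilate_aux hc (Lp.coeFn_smul a ξ),
      Lp.coeFn_smul a ((memLp_dilate hc ξ).toLp _)] with x h1 h2 h3 h4
    rw [h1, RingHom.id_apply, h4, Pi.smul_apply, h2, h3, Pi.smul_apply, smul_eq_mul, smul_eq_mul,
      mul_left_comm]
  norm_map' ξ := by
    change ‖(memLp_dilate hc ξ).toLp _‖ = ‖ξ‖
    rw [Lp.norm_toLp, Lp.norm_def]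
    congr 1
    have h1 : eLpNorm (fun x : ℝ => ξ (x / c)) 2 volume
        = eLpNorm ξ 2 (ENNReal.ofReal c • volume) :=
      eLpNorm_comp_measurePreserving
        ((Lp.aestronglyMeasurable ξ).smul_measure _) (measurePreserving_div hc)
    have h2 : (fun x : ℝ => ((√c)⁻¹ : ℂ) * ξ (x / c))
        = ((√c)⁻¹ : ℂ) • fun x : ℝ => ξ (x / c) := rfl
    have h0 : 0 < √c := Real.sqrt_pos.mpr hc
    rw [h2, eLpNorm_const_smul, h1,
      eLpNorm_smul_measure_of_ne_zero (by simpa using hc), smul_eq_mul, ← mul_assoc]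
    have h3 : ‖((√c)⁻¹ : ℂ)‖ₑ * ENNReal.ofReal c ^ (1 / (2 : ℝ≥0∞)).toReal = 1 := by
      have e1 : ‖((√c)⁻¹ : ℂ)‖ₑ = ENNReal.ofReal (√c)⁻¹ := by
        rw [← ofReal_norm, norm_inv, Complex.norm_real, Real.norm_of_nonneg h0.le]
      have e2 : ENNReal.ofReal c ^ (1 / (2 : ℝ≥0∞)).toReal = ENNReal.ofReal √c := by
        rw [ENNReal.ofReal_rpow_of_pos hc, Real.sqrt_eq_rpow]
        norm_num
      rw [e1, e2, ← ENNReal.ofReal_mul (inv_nonneg.mpr h0.le), inv_mul_cancel₀ h0.ne',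
        ENNReal.ofReal_one]
    rw [h3, one_mul]

theorem dilationIsometry_ae (c : ℝ) (hc : 0 < c) (ξ : L2R) :
    dilationIsometry c hc ξ =ᵐ[volume] fun x => ((√c)⁻¹ : ℂ) * ξ (x / c) :=
  (memLp_dilate hc ξ).coeFn_toLp

theorem dilationIsometry_surjective (c : ℝ) (hc : 0 < c) :
    Function.Surjective (dilationIsometry c hc) := by
  intro ξ
  refine ⟨dilationIsometry c⁻¹ (inv_pos.mpr hc) ξ, ?_⟩
  apply Lp.ext
  have h0 : 0 < √c := Real.sqrt_pos.mpr hc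
  filter_upwards [dilationIsometry_ae c hc (dilationIsometry c⁻¹ (inv_pos.mpr hc) ξ),
    dilate_aux hc (dilationIsometry_ae c⁻¹ (inv_pos.mpr hc) ξ)] with x h1 h2
  rw [h1, h2]
  have h3 : ((√c : ℝ) : ℂ) ≠ 0 := by exact_mod_cast h0.ne'
  have h4 : x / c / c⁻¹ = x := by field_simp
  rw [h4, Real.sqrt_inv]
  push_cast
  rw [inv_inv, ← mul_assoc, inv_mul_cancel₀ h3, one_mul]

/-- The scaling unitary `(U_N ξ)(x) = N^{-1/2} ξ(x / N)` on `L²(ℝ)`. -/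
def scaling (N : ℕ) [NeZero N] : L2R ≃ₗᵢ[ℂ] L2R :=
  LinearIsometryEquiv.ofSurjective
    (dilationIsometry (N : ℝ) (Nat.cast_pos.mpr (NeZero.pos N)))
    (dilationIsometry_surjective _ _)

theorem scaling_ae (N : ℕ) [NeZero N] (ξ : L2R) :
    scaling N ξ =ᵐ[volume] fun x => ((√(N : ℝ))⁻¹ : ℂ) * ξ (x / N) :=
  dilationIsometry_ae (N : ℝ) (Nat.cast_pos.mpr (NeZero.pos N)) ξ

/-! ### Father and mother functions -/

/-- The closed linear span `𝒱₀` of the integer translates of `φ`. -/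
def V0 (φ : L2R) : Submodule ℂ L2R :=
  (Submodule.span ℂ (Set.range fun k : ℤ => (translation ^ k) φ)).topologicalClosure

/-- The subspace `𝒱ₙ = U_Nⁿ 𝒱₀`. -/
def V (N : ℕ) [NeZero N] (φ : L2R) (n : ℤ) : Submodule ℂ L2R :=
  (V0 φ).map (scaling N ^ n).toLinearEquiv.toLinearMap

/-- `φ` is a father function in scale `N`. -/
structure IsFather (N : ℕ) [NeZero N] (φ : L2R) : Prop where
  orthonormal : Orthonormal ℂ fun k : ℤ => (translation ^ k) φ
  scaling_mem : scaling N φ ∈ V0 φ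
  iInf_eq : ⨅ n : ℤ, V N φ n = ⊥
  iSup_eq : (⨆ n : ℤ, V N φ n).topologicalClosure = ⊤

/-- `ψ₁, …, ψ_{N-1}` are mother functions for `φ`: their integer translates form an orthonormal
basis of `𝒱₀^⊥ ∩ 𝒱₋₁`. -/
structure IsMother (N : ℕ) [NeZero N] (φ : L2R) (ψ : Fin (N - 1) → L2R) : Prop where
  orthonormal : Orthonormal ℂ fun p : Fin (N - 1) × ℤ => (translation ^ p.2) (ψ p.1)
  span_eq : (Submodule.span ℂ (Set.range fun p : Fin (N - 1) × ℤ =>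
    (translation ^ p.2) (ψ p.1))).topologicalClosure = (V0 φ)ᗮ ⊓ V N φ (-1)

/-- The wavelet `U_N^j T^k ψ_i`, indexed by `(i, j, k)`. -/
def wavelet (N : ℕ) [NeZero N] (ψ : Fin (N - 1) → L2R) (p : Fin (N - 1) × ℤ × ℤ) : L2R :=
  (scaling N ^ p.2.1) ((translation ^ p.2.2) (ψ p.1))

/-- The wavelet coefficient `a_{jk}^{(i)}(ξ) = ⟨U_N^j T^k ψ_i, ξ⟩`. -/
def waveletCoeff (N : ℕ) [NeZero N] (ψ : Fin (N - 1) → L2R) (ξ : L2R)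
    (i : Fin (N - 1)) (j k : ℤ) : ℂ :=
  ⟪wavelet N ψ (i, j, k), ξ⟫_ℂ

/-! ### Fourier transforms -/

/-- The unitary Fourier transform on `L²(ℝ)` in the normalization
`ξ̂(t) = (2π)^{-1/2} ∫ e^{-itx} ξ(x) dx`. Mathlib's transform has kernel `e^{-2πitx}`. -/
def hat (ξ : L2R) : ℝ → ℂ := fun t =>
  ((√(2 * π))⁻¹ : ℂ) * (𝓕 ξ : L2R) (t / (2 * π))

/-- The Fourier coefficient of `g ∈ L²(𝕋)` at `z^k`, where `𝕋` has the coordinate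
`z = e^{-it}`: `g̃(k) = (2π)⁻¹ ∫_{-π}^{π} \overline{e^{-ikt}} g(t) dt`. -/
def circleCoeff (g : L2T) (k : ℤ) : ℂ :=
  (1 / (2 * π) : ℂ) * ∫ t in (-π)..π, Complex.exp (Complex.I * k * t) * g (t : AddCircle (2 * π))

/-! ### Filters and the isometries on the circle -/

/-- The function `m_η(t) = ∑_k η_k e^{-ikt}` in `L²(𝕋)`, where the `η_k` are the coefficients in
`U_N η = ∑_k η_k φ(· - k)`, for `φ` with orthonormal translates and `U_N η ∈ 𝒱₀`. -/
def filterFn (N : ℕ) [NeZero N] (φ η : L2R) : L2T :=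
  ∑' k : ℤ, ⟪(translation ^ k) φ, scaling N η⟫_ℂ • (fourierLp 2 (-k) : L2T)

theorem measurePreserving_nsmul (N : ℕ) [NeZero N] :
    MeasurePreserving (fun t : AddCircle (2 * π) => N • t) haarAddCircle haarAddCircle := by
  have h := Measure.measurePreserving_zsmul (haarAddCircle : Measure (AddCircle (2 * π)))
    (n := (N : ℤ)) (by exact_mod_cast NeZero.ne N)
  simpa using h

open Classical in
/-- Multiplication by an essentially bounded `m`; the value `0` for other `m` is a dummy. -/
def mulOp (m : L2T) : L2T →L[ℂ] L2T :=
  if h : MemLp m ∞ haarAddCircle then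
    (ContinuousLinearMap.mul ℂ ℂ).holderL haarAddCircle ∞ 2 2 (h.toLp m)
  else 0

/-- The operator `(S ξ)(t) = m(t) ξ(N t)` on `L²(𝕋)`, for essentially bounded `m`. -/
def cuntzOp (N : ℕ) [NeZero N] (m : L2T) : L2T →L[ℂ] L2T :=
  mulOp m ∘L (Lp.compMeasurePreservingₗᵢ ℂ (fun t : AddCircle (2 * π) => N • t)
    (measurePreserving_nsmul N)).toContinuousLinearMap

theorem cuntzOp_ae (N : ℕ) [NeZero N] (m : L2T) (hm : MemLp m ∞ haarAddCircle) (ξ : L2T) :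
    cuntzOp N m ξ =ᵐ[haarAddCircle] fun t => m t * ξ (N • t) := by
  have e : cuntzOp N m ξ = (ContinuousLinearMap.mul ℂ ℂ).holder 2 (hm.toLp m)
      (Lp.compMeasurePreserving _ (measurePreserving_nsmul N) ξ) := by
    simp only [cuntzOp, mulOp, dif_pos hm]
    rfl
  rw [e]
  filter_upwards [(ContinuousLinearMap.mul ℂ ℂ).coeFn_holder (r := 2) (hm.toLp m)
      (Lp.compMeasurePreserving _ (measurePreserving_nsmul N) ξ), hm.coeFn_toLp,
      Lp.coeFn_compMeasurePreserving ξ (measurePreserving_nsmul N)] with t h1 h2 h3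
  rw [h1, h2, h3]
  rfl

end ScaleWavelet

end

open ScaleWavelet

/-! The spaces `V N φ n` decrease in `n`, and the wavelets of scale `j` span densely the orthogonal
complement of 𝒱_j in 𝒱_{j-1}. Hence all wavelets are orthonormal, and the two limit conditions on
the 𝒱_n make them complete (`mem_V0_iff`, `hasSum_wavelet`).

For the coefficients, 𝒱₀ is identified with L²(𝕋) by the isometry `synthesis`, which sends e^{-ikt}
to T^k φ. On the Fourier side it is multiplication of φ̂ by f, so the equation ξ̂ = f φ̂ says
exactly that `synthesis` maps f to ξ (`hat_ae_eq_iff`). The relation U_N T^k = T^{Nk} U_N turns U_N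
on 𝒱₀ into S₀ (`synthesis_cuntzOp`) and U_N T^k ψ_i into S_i e^{-ikt}
(`synthesis_cuntzOp_fourierLp`). For j ≥ 1 the wavelet U_N^j T^k ψ_i is therefore the image of
S₀^{j-1} S_i e^{-ikt}, and taking adjoints gives the formula.

The filters are bounded because f ↦ m f(N·) is isometric: |m|² has mean 1 over almost every fibre of
t ↦ N t, and a fibre has N points (`memLp_top_of_isometry`). -/

noncomputable section

namespace ScaleWavelet

/-! ### Multiresolution analysis: orthonormality and completeness of the wavelets -/

section Multiresolution

variable {N : ℕ} [NeZero N] {φ : L2R} {ψ : Fin (N - 1) → L2R}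

theorem scaling_zpow_add (m n : ℤ) (x : L2R) :
    (scaling N ^ (m + n)) x = (scaling N ^ m) ((scaling N ^ n) x) := by
  rw [zpow_add]; rfl

theorem translation_zpow_add (m n : ℤ) (x : L2R) :
    (translation ^ (m + n)) x = (translation ^ m) ((translation ^ n) x) := by
  rw [zpow_add]; rfl

theorem inner_scaling_zpow (n : ℤ) (x y : L2R) :
    ⟪(scaling N ^ n) x, y⟫_ℂ = ⟪x, (scaling N ^ (-n)) y⟫_ℂ := by
  rw [← LinearIsometryEquiv.inner_map_map (scaling N ^ (-n)), ← scaling_zpow_add]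
  simp

theorem mem_V {n : ℤ} {x : L2R} : x ∈ V N φ n ↔ (scaling N ^ (-n)) x ∈ V0 φ := by
  constructor
  · rintro ⟨y, hy, rfl⟩
    change (scaling N ^ (-n)) ((scaling N ^ n) y) ∈ V0 φ
    rw [← scaling_zpow_add]
    simpa using hy
  · intro h
    refine ⟨_, h, ?_⟩
    change (scaling N ^ n) ((scaling N ^ (-n)) x) = x
    rw [← scaling_zpow_add]
    simp

theorem scaling_zpow_mem_V {m n : ℤ} {x : L2R} :
    (scaling N ^ m) x ∈ V N φ n ↔ x ∈ V N φ (n - m) := by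
  rw [mem_V, mem_V, ← scaling_zpow_add]
  congr! 3
  ring_nf

theorem V_zero : V N φ 0 = V0 φ := by
  ext x; simp [mem_V]

theorem isClosed_V0 : IsClosed (V0 φ : Set L2R) :=
  Submodule.isClosed_topologicalClosure _

theorem isClosed_V (n : ℤ) : IsClosed (V N φ n : Set L2R) := by
  have : (V N φ n : Set L2R) = (scaling N ^ (-n)) ⁻¹' (V0 φ) := by
    ext x; exact mem_V
  rw [this]
  exact isClosed_V0.preimage (scaling N ^ (-n)).continuous

theorem translation_zpow_mem_V0 (k : ℤ) : (translation ^ k) φ ∈ V0 φ :=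
  Submodule.le_topologicalClosure _ (Submodule.subset_span ⟨k, rfl⟩)

theorem translation_zpow_apply_mem_V0 (k : ℤ) {x : L2R} (hx : x ∈ V0 φ) :
    (translation ^ k) x ∈ V0 φ := by
  have hle : V0 φ ≤ (V0 φ).comap (translation ^ k).toLinearEquiv.toLinearMap := by
    refine Submodule.topologicalClosure_minimal _ ?_
      (isClosed_V0.preimage (translation ^ k).continuous)
    rw [Submodule.span_le]
    rintro _ ⟨l, rfl⟩
    change (translation ^ k) ((translation ^ l) φ) ∈ V0 φ
    rw [← translation_zpow_add]
    exact translation_zpow_mem_V0 _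
  exact hle hx

theorem translation_zpow_ae (k : ℤ) (x : L2R) :
    (translation ^ k) x =ᵐ[volume] fun t => x (t - k) := by
  have hadd (l : ℤ) (y : L2R) : (translation ^ (l + 1)) y =ᵐ[volume]
      fun t => (translation ^ l) y (t - 1) := by
    rw [add_comm, translation_zpow_add, zpow_one]
    exact translation_ae _
  induction k using Int.induction_on with
  | zero => simp
  | succ k ih =>
    filter_upwards [hadd k x,
      (measurePreserving_sub 1).quasiMeasurePreserving.ae ih] with t h1 h2
    rw [h1, h2]
    push_cast
    ring_nf
  -- The recursion is read at `t + 1` in order to invert one translation.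
  | pred k ih =>
    have h := hadd (-k - 1) x
    rw [sub_add_cancel] at h
    filter_upwards [(measurePreserving_sub (-1)).quasiMeasurePreserving.ae h,
      (measurePreserving_sub (-1)).quasiMeasurePreserving.ae ih] with t h1 h2
    rw [h2] at h1
    have e : t - -1 - 1 = t := by ring
    rw [e] at h1
    rw [← h1]
    push_cast
    ring_nf

/-- Both sides evaluate `x` at t/N - k = (t - Nk)/N. This commutation relation gives the nesting of
the 𝒱_n and, later, the intertwining with the operators on the circle. -/
theorem scaling_translation_zpow (k : ℤ) (x : L2R) :
    scaling N ((translation ^ k) x) = (translation ^ (N * k)) (scaling N x) := by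
  have hN : (N : ℝ) ≠ 0 := Nat.cast_ne_zero.2 (NeZero.ne N)
  apply Lp.ext
  filter_upwards [scaling_ae N ((translation ^ k) x), translation_zpow_ae (N * k) (scaling N x),
    (measurePreserving_sub ((N * k : ℤ) : ℝ)).quasiMeasurePreserving.ae (scaling_ae N x),
    dilate_aux (Nat.cast_pos.2 (NeZero.pos N)) (translation_zpow_ae k x)] with t h1 h2 h3 h4
  rw [h1, h2, h3, h4]
  congr 2
  push_cast
  field_simp

theorem exists_sub_mem_orthogonal (n : ℤ) (x : L2R) :
    ∃ p ∈ V N φ n, x - p ∈ (V N φ n)ᗮ := by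
  have : CompleteSpace (V N φ n) := (isClosed_V n).completeSpace_coe
  exact ⟨_, (V N φ n).starProjection_apply_mem x, Submodule.sub_starProjection_mem_orthogonal x⟩

theorem IsFather.V_succ_le (hφ : IsFather N φ) (n : ℤ) : V N φ (n + 1) ≤ V N φ n := by
  have hle : V0 φ ≤ V N φ (-1) := by
    refine Submodule.topologicalClosure_minimal _ ?_ (isClosed_V _)
    rw [Submodule.span_le]
    rintro _ ⟨k, rfl⟩
    simp only [SetLike.mem_coe, mem_V, neg_neg, zpow_one, scaling_translation_zpow]
    exact translation_zpow_apply_mem_V0 _ hφ.scaling_mem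
  intro x hx
  rw [mem_V] at hx ⊢
  have := mem_V.1 (hle hx)
  rw [← scaling_zpow_add] at this
  convert this using 3
  ring_nf

theorem IsFather.antitone_V (hφ : IsFather N φ) : Antitone (V N φ) :=
  antitone_int_of_succ_le hφ.V_succ_le

theorem translation_zpow_mother_mem (hψ : IsMother N φ ψ) (i : Fin (N - 1)) (k : ℤ) :
    (translation ^ k) (ψ i) ∈ (V0 φ)ᗮ ⊓ V N φ (-1) := by
  rw [← hψ.span_eq]
  exact Submodule.le_topologicalClosure _ (Submodule.subset_span ⟨(i, k), rfl⟩)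

theorem wavelet_mem_V (hψ : IsMother N φ ψ) (i : Fin (N - 1)) (j k : ℤ) :
    wavelet N ψ (i, j, k) ∈ V N φ (j - 1) := by
  rw [wavelet, scaling_zpow_mem_V, show j - 1 - j = -1 by ring]
  exact (translation_zpow_mother_mem hψ i k).2

theorem inner_wavelet_eq_zero (hψ : IsMother N φ ψ) (i : Fin (N - 1)) (j k : ℤ) {x : L2R}
    (hx : x ∈ V N φ j) : ⟪wavelet N ψ (i, j, k), x⟫_ℂ = 0 := by
  rw [wavelet, inner_scaling_zpow]
  exact Submodule.inner_left_of_mem_orthogonal (mem_V.1 hx) (translation_zpow_mother_mem hψ i k).1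

/-- The component of `x` orthogonal to 𝒱_j, moved back by U_N^{-j}, lies in 𝒱₀^⊥ ∩ 𝒱₋₁. It is also
orthogonal to the basis T^k ψ_i of that space, so it vanishes. -/
theorem mem_V_of_inner_wavelet (hφ : IsFather N φ) (hψ : IsMother N φ ψ) (j : ℤ) {x : L2R}
    (hx : x ∈ V N φ (j - 1)) (h : ∀ i k, ⟪wavelet N ψ (i, j, k), x⟫_ℂ = 0) : x ∈ V N φ j := by
  obtain ⟨p, hp, hq⟩ := exists_sub_mem_orthogonal (N := N) (φ := φ) j x
  set q := x - p with hqdef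
  have hq1 : q ∈ V N φ (j - 1) := Submodule.sub_mem _ hx (hφ.antitone_V (by omega) hp)
  have hW : (scaling N ^ (-j)) q ∈ (V0 φ)ᗮ ⊓ V N φ (-1) := by
    refine ⟨fun y hy => ?_, ?_⟩
    · have := hq ((scaling N ^ j) y) ⟨y, hy, rfl⟩
      rwa [inner_scaling_zpow] at this
    · rw [SetLike.mem_coe, scaling_zpow_mem_V, show -1 - -j = j - 1 by ring]
      exact hq1
  have hWo : (scaling N ^ (-j)) q ∈ ((V0 φ)ᗮ ⊓ V N φ (-1))ᗮ := by
    rw [← hψ.span_eq, Submodule.orthogonal_closure, Submodule.mem_orthogonal]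
    intro u hu
    induction hu using Submodule.span_induction with
    | mem u hu =>
      obtain ⟨⟨i, k⟩, rfl⟩ := hu
      have h1 := h i k
      have h2 := inner_wavelet_eq_zero hψ i j k hp
      rw [wavelet, inner_scaling_zpow] at h1 h2
      simp only [hqdef, map_sub, inner_sub_right, h1, h2, sub_zero]
    | zero => simp
    | add u v _ _ hu hv => rw [inner_add_left, hu, hv, add_zero]
    | smul c u _ hu => rw [inner_smul_left, hu, mul_zero]
  have h0 : (scaling N ^ (-j)) q = 0 := inner_self_eq_zero.1 (hWo _ hW)
  have : q = 0 := by simpa using h0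
  rw [hqdef, sub_eq_zero] at this
  rwa [this]

/-- Every 𝒱_n lies in some 𝒱_{-m} with m ≥ 0, so `x` is orthogonal to the dense union. -/
theorem IsFather.eq_zero_of_orthogonal (hφ : IsFather N φ) {x : L2R}
    (h : ∀ n : ℕ, x ∈ (V N φ (-n))ᗮ) : x = 0 := by
  have h1 : (⨆ n : ℤ, V N φ n) ≤ (Submodule.span ℂ {x})ᗮ := by
    refine iSup_le fun n y hy => ?_
    rw [Submodule.mem_orthogonal_singleton_iff_inner_right]
    exact Submodule.inner_left_of_mem_orthogonal
      (hφ.antitone_V (by omega : -(n.natAbs : ℤ) ≤ n) hy) (h n.natAbs)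
  have h2 := Submodule.topologicalClosure_minimal _ h1 (Submodule.isClosed_orthogonal _)
  rw [hφ.iSup_eq] at h2
  have h3 := (Submodule.mem_orthogonal_singleton_iff_inner_right).1 (h2 (Submodule.mem_top (x := x)))
  exact inner_self_eq_zero.1 h3

/-- An element of `L²(ℝ)` lies in `𝒱₀` iff its wavelet coefficients at the scales `j ≤ 0` vanish. -/
theorem mem_V0_iff (hφ : IsFather N φ) (hψ : IsMother N φ ψ) (x : L2R) :
    x ∈ V0 φ ↔ ∀ (i : Fin (N - 1)) (j k : ℤ), j ≤ 0 → waveletCoeff N ψ x i j k = 0 := by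
  constructor
  · intro hx i j k hj
    refine inner_wavelet_eq_zero hψ i j k (hφ.antitone_V hj ?_)
    rwa [V_zero]
  intro h
  obtain ⟨p, hp, hxp⟩ := exists_sub_mem_orthogonal (N := N) (φ := φ) 0 x
  -- Passing to finer scales does not change the projection of `x`: its projection `q` to 𝒱_{-n-1}
  -- has no component at scale -n, hence lies in 𝒱_{-n} and must equal `p`.
  have key : ∀ n : ℕ, x - p ∈ (V N φ (-n))ᗮ := by
    intro n
    induction n with
    | zero => simpa using hxp
    | succ n ih =>
      obtain ⟨q, hq, hxq⟩ := exists_sub_mem_orthogonal (N := N) (φ := φ) (-((n + 1 : ℕ) : ℤ)) x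
      have hle : V N φ (-n) ≤ V N φ (-((n + 1 : ℕ) : ℤ)) := hφ.antitone_V (by push_cast; omega)
      have hq' : q ∈ V N φ (-n) := by
        refine mem_V_of_inner_wavelet hφ hψ _ ?_ fun i k => ?_
        · convert hq using 2
          push_cast; ring
        · have h1 : ⟪wavelet N ψ (i, -n, k), x - q⟫_ℂ = 0 := by
            refine hxq _ ?_
            have := wavelet_mem_V hψ i (-n) k
            convert this using 2
            push_cast; ring
          rw [inner_sub_right, sub_eq_zero] at h1
          rw [← h1]
          exact h i (-n) k (by omega)
      have hp' : p ∈ V N φ (-n) := hφ.antitone_V (by omega) hp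
      have hd : q - p ∈ (V N φ (-n))ᗮ := by
        have := Submodule.sub_mem _ ih (Submodule.orthogonal_le hle hxq)
        simpa using this
      have : q - p = 0 := inner_self_eq_zero.1 (hd _ (Submodule.sub_mem _ hq' hp'))
      rwa [← sub_eq_zero.1 this]
  have := hφ.eq_zero_of_orthogonal key
  rw [sub_eq_zero.1 this, ← V_zero (N := N)]
  exact hp

theorem orthonormal_wavelet (hφ : IsFather N φ) (hψ : IsMother N φ ψ) :
    Orthonormal ℂ (wavelet N ψ) := by
  -- A wavelet of scale j' > j lies in 𝒱_{j'-1} ⊆ 𝒱_j, which is orthogonal to the wavelets of scale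
  -- j.
  have hlt : ∀ (i i' : Fin (N - 1)) (j j' k k' : ℤ), j < j' →
      ⟪wavelet N ψ (i, j, k), wavelet N ψ (i', j', k')⟫_ℂ = 0 := fun i i' j j' k k' h =>
    inner_wavelet_eq_zero hψ i j k (hφ.antitone_V (by omega) (wavelet_mem_V hψ i' j' k'))
  refine ⟨fun ⟨i, j, k⟩ => ?_, ?_⟩
  · rw [wavelet, LinearIsometryEquiv.norm_map]
    exact hψ.orthonormal.1 (i, k)
  · rintro ⟨i, j, k⟩ ⟨i', j', k'⟩ hne
    rcases lt_trichotomy j j' with h | rfl | h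
    · exact hlt _ _ _ _ _ _ h
    · rw [wavelet, wavelet, LinearIsometryEquiv.inner_map_map]
      refine hψ.orthonormal.2 (i := (i, k)) (j := (i', k')) ?_
      rintro ⟨⟩
      exact hne rfl
    · exact inner_eq_zero_symm.1 (hlt _ _ _ _ _ _ h)

/-- Scaling only shifts the index j, so the criterion for 𝒱₀ applies to every U_N^{-n} x and places
`x` in the intersection of all 𝒱_n. -/
theorem eq_zero_of_waveletCoeff_eq_zero (hφ : IsFather N φ) (hψ : IsMother N φ ψ) {x : L2R}
    (h : ∀ i j k, waveletCoeff N ψ x i j k = 0) : x = 0 := by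
  have : x ∈ ⨅ n : ℤ, V N φ n := by
    rw [Submodule.mem_iInf]
    intro n
    rw [mem_V, mem_V0_iff hφ hψ]
    intro i j k _
    have := h i (j + n) k
    rwa [waveletCoeff, wavelet, add_comm, scaling_zpow_add, inner_scaling_zpow] at this
  simpa [hφ.iInf_eq] using this

theorem hasSum_wavelet (hφ : IsFather N φ) (hψ : IsMother N φ ψ) (x : L2R) :
    HasSum (fun p : Fin (N - 1) × ℤ × ℤ =>
      waveletCoeff N ψ x p.1 p.2.1 p.2.2 • wavelet N ψ p) x := by
  have hbot : (Submodule.span ℂ (Set.range (wavelet N ψ)))ᗮ = ⊥ := by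
    rw [Submodule.eq_bot_iff]
    intro y hy
    exact eq_zero_of_waveletCoeff_eq_zero hφ hψ fun i j k =>
      hy _ (Submodule.subset_span ⟨(i, j, k), rfl⟩)
  have := (HilbertBasis.mkOfOrthogonalEqBot (orthonormal_wavelet hφ hψ) hbot).hasSum_repr x
  simp only [HilbertBasis.repr_apply_apply, HilbertBasis.coe_mkOfOrthogonalEqBot] at this
  exact this

end Multiresolution

open Filter Topology

/-! ### Weighted composition relations under L² limits -/

section WeightedComposition

variable {X Y : Type*} {mX : MeasurableSpace X} {mY : MeasurableSpace Y} {μ : Measure X}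
  {ν : Measure Y}

/-- The relation `v = w · (u ∘ q)` between elements of `L²` is closed. -/
theorem isClosed_setOf_ae_eq_mul_comp (w : X → ℂ) {q : X → Y}
    (hq : Measure.QuasiMeasurePreserving q μ ν) :
    IsClosed {p : Lp ℂ 2 ν × Lp ℂ 2 μ | p.2 =ᵐ[μ] fun x => w x * p.1 (q x)} := by
  refine IsSeqClosed.isClosed fun p p₀ hp hlim => ?_
  have h1 : Tendsto (fun n => (p n).1) atTop (𝓝 p₀.1) :=
    (continuous_fst.tendsto p₀).comp hlim
  have h2 : Tendsto (fun n => (p n).2) atTop (𝓝 p₀.2) :=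
    (continuous_snd.tendsto p₀).comp hlim
  -- L² convergence yields almost everywhere convergence along a subsequence; a second extraction
  -- handles both components at once. No bound on `w` is needed.
  obtain ⟨a, ha, ha'⟩ := (tendstoInMeasure_of_tendsto_Lp h1).exists_seq_tendsto_ae
  obtain ⟨b, hb, hb'⟩ := (tendstoInMeasure_of_tendsto_Lp
    (h2.comp ha.tendsto_atTop)).exists_seq_tendsto_ae
  filter_upwards [hb', hq.ae ha', ae_all_iff.2 hp] with x hx1 hx2 hx3
  refine tendsto_nhds_unique hx1 ?_
  refine (((hx2.comp hb.tendsto_atTop).const_mul (w x))).congr fun n => ?_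
  exact (hx3 (a (b n))).symm

theorem ae_eq_mul_comp_of_dense {E : Type*} [TopologicalSpace E] {D : Set E} (hD : Dense D)
    {A : E → Lp ℂ 2 ν} {B : E → Lp ℂ 2 μ} (hA : Continuous A) (hB : Continuous B)
    (w : X → ℂ) {q : X → Y} (hq : Measure.QuasiMeasurePreserving q μ ν)
    (h : ∀ x ∈ D, B x =ᵐ[μ] fun t => w t * A x (q t)) (x : E) :
    B x =ᵐ[μ] fun t => w t * A x (q t) := by
  have hcl := (isClosed_setOf_ae_eq_mul_comp w hq).preimage (hA.prodMk hB)
  exact hcl.closure_subset_iff.2 (fun x hx => h x hx) (hD x)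

end WeightedComposition

/-! ### Operators on L²(𝕋) determined by their values on the monomials -/

section FourierExtend

theorem dense_span_fourierLp :
    Dense (Submodule.span ℂ (Set.range fun n : ℤ => (fourierLp 2 n : L2T)) : Set L2T) := by
  rw [dense_iff_closure_eq, ← Submodule.topologicalClosure_coe,
    span_fourierLp_closure_eq_top (by simp), Submodule.top_coe]

theorem fourierLp_ae (n : ℤ) :
    (fourierLp 2 n : L2T) =ᵐ[haarAddCircle] fun t => fourier n t := coeFn_fourierLp 2 n

/-- If a bounded operator acts on the Fourier monomials as a weighted composition operator, then it
is one. -/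
theorem ae_eq_mul_comp_of_fourierLp {X : Type*} {mX : MeasurableSpace X} {μ : Measure X}
    (M : L2T →L[ℂ] Lp ℂ 2 μ) (w : X → ℂ) {q : X → AddCircle (2 * π)}
    (hq : Measure.QuasiMeasurePreserving q μ haarAddCircle)
    (h : ∀ n : ℤ, M (fourierLp 2 n) =ᵐ[μ] fun t => w t * fourier n (q t)) (f : L2T) :
    M f =ᵐ[μ] fun t => w t * f (q t) := by
  refine ae_eq_mul_comp_of_dense (A := id) dense_span_fourierLp continuous_id M.continuous w hq
    (fun f hf => ?_) f
  induction hf using Submodule.span_induction with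
  | mem f hf =>
    obtain ⟨n, rfl⟩ := hf
    filter_upwards [h n, hq.ae (fourierLp_ae n)] with t h1 h2
    rw [h1, id, h2]
  | zero =>
    filter_upwards [Lp.coeFn_zero ℂ 2 μ, hq.ae (Lp.coeFn_zero ℂ 2 haarAddCircle)] with t h1 h2
    rw [map_zero, h1, id, h2]
    simp
  | add f g _ _ hf hg =>
    filter_upwards [hf, hg, Lp.coeFn_add (M f) (M g), hq.ae (Lp.coeFn_add f g)] with t h1 h2 h3 h4
    rw [map_add, h3, id, h4]
    simp only [Pi.add_apply, h1, h2, id, mul_add]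
  | smul c f _ hf =>
    filter_upwards [hf, Lp.coeFn_smul c (M f), hq.ae (Lp.coeFn_smul c f)] with t h1 h2 h3
    rw [map_smul, h2, id, h3]
    simp only [Pi.smul_apply, h1, id, smul_eq_mul]
    ring

theorem clm_ext_fourierLp {E : Type*} [NormedAddCommGroup E] [NormedSpace ℂ E]
    {A B : L2T →L[ℂ] E} (h : ∀ n : ℤ, A (fourierLp 2 n) = B (fourierLp 2 n)) : A = B := by
  refine ContinuousLinearMap.ext_on dense_span_fourierLp ?_
  rintro _ ⟨n, rfl⟩
  exact h n

variable {E : Type*} [NormedAddCommGroup E] [InnerProductSpace ℂ E] [CompleteSpace E]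

/-- The isometry of `L²(𝕋)` sending the monomials `fourier n` to a given orthonormal family. -/
def fourierExtend {v : ℤ → E} (hv : Orthonormal ℂ v) : L2T →ₗᵢ[ℂ] E :=
  hv.orthogonalFamily.linearIsometry.comp fourierBasis.repr.toLinearIsometry

@[simp]
theorem fourierExtend_fourierLp {v : ℤ → E} (hv : Orthonormal ℂ v) (n : ℤ) :
    fourierExtend hv (fourierLp 2 n) = v n := by
  classical
  have : fourierBasis.repr (fourierLp 2 n : L2T) = lp.single 2 n (1 : ℂ) := by
    rw [← coe_fourierBasis, HilbertBasis.repr_self]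
  change hv.orthogonalFamily.linearIsometry (fourierBasis.repr (fourierLp 2 n : L2T)) = v n
  rw [this, OrthogonalFamily.linearIsometry_apply_single, LinearIsometry.toSpanSingleton_apply,
    one_smul]

theorem mem_range_fourierExtend {v : ℤ → E} (hv : Orthonormal ℂ v) {x : E}
    (hx : x ∈ (Submodule.span ℂ (Set.range v)).topologicalClosure) :
    ∃ f, fourierExtend hv f = x := by
  have hle : (Submodule.span ℂ (Set.range v)).topologicalClosure ≤
      (fourierExtend hv).toLinearMap.range := by
    refine Submodule.topologicalClosure_minimal _ ?_
      (fourierExtend hv).isometry.isClosedEmbedding.isClosed_range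
    rw [Submodule.span_le]
    rintro _ ⟨n, rfl⟩
    exact ⟨_, fourierExtend_fourierLp hv n⟩
  exact hle hx

end FourierExtend

/-! ### The Fourier transform on the line and translations -/

section Fourier

/-- The line is a countable union of intervals of length 2π, and on each of them the preimage of a
null set is null. -/
theorem quasiMeasurePreserving_coe_addCircle :
    Measure.QuasiMeasurePreserving (fun t : ℝ => (t : AddCircle (2 * π))) volume
      haarAddCircle := by
  refine ⟨AddCircle.measurable_mk', Measure.AbsolutelyContinuous.mk fun s hs h0 => ?_⟩
  have hv : volume s = 0 := by
    rw [volume_eq_smul_haarAddCircle, Measure.smul_apply, h0, smul_zero]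
  rw [Measure.map_apply AddCircle.measurable_mk' hs]
  have hcov : (fun t : ℝ => (t : AddCircle (2 * π))) ⁻¹' s ⊆
      ⋃ n : ℤ, (fun t : ℝ => (t : AddCircle (2 * π))) ⁻¹' s ∩
        Set.Ioc (n • (2 * π)) ((n + 1) • (2 * π)) := by
    rw [← Set.inter_iUnion, iUnion_Ioc_zsmul Real.two_pi_pos, Set.inter_univ]
  refine measure_mono_null hcov (measure_iUnion_null fun n => ?_)
  rw [add_smul, one_smul]
  exact (AddCircle.add_projection_respects_measure (2 * π) (n • (2 * π)) hs).symm.trans hv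

theorem fourier_schwartz_compSubConst (f : SchwartzMap ℝ ℂ) (a w : ℝ) :
    𝓕 (f.compSubConstCLM ℂ a) w = Complex.exp (-(2 * π * a * w * Complex.I)) * 𝓕 f w := by
  have := congr_fun (VectorFourier.fourierIntegral_comp_add_right Real.fourierChar volume
    (innerₗ ℝ) f (-a)) w
  refine (Eq.trans ?_ this).trans ?_
  · rfl
  · rw [Circle.smul_def, Real.fourierChar_apply, smul_eq_mul]
    congr 2
    simp
    ring

theorem toLp_compSubConst (f : SchwartzMap ℝ ℂ) :
    (f.compSubConstCLM ℂ (1 : ℝ)).toLp 2 = translation (f.toLp 2) := by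
  apply Lp.ext
  filter_upwards [translation_ae (f.toLp 2),
    (measurePreserving_sub 1).quasiMeasurePreserving.ae (f.coeFn_toLp 2 volume),
    (f.compSubConstCLM ℂ (1 : ℝ)).coeFn_toLp 2 volume] with t h1 h2 h3
  rw [h1, h2, h3]
  rfl

/-- The phase rule holds for Schwartz functions, which are dense, and it survives L² limits. -/
theorem fourier_translation_ae (x : L2R) :
    (𝓕 (translation x) : L2R) =ᵐ[volume]
      fun w => Complex.exp (-(2 * π * w * Complex.I)) * (𝓕 x : L2R) w := by
  have hd : DenseRange (fun f : SchwartzMap ℝ ℂ => f.toLp 2 (volume : Measure ℝ)) :=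
    SchwartzMap.denseRange_toLpCLM ENNReal.ofNat_ne_top
  have hc : Continuous fun y : L2R => (𝓕 y : L2R) := (Lp.fourierTransformₗᵢ ℝ ℂ).continuous
  refine ae_eq_mul_comp_of_dense hd hc (hc.comp translation.continuous) _
    (Measure.QuasiMeasurePreserving.id volume) ?_ x
  rintro _ ⟨f, rfl⟩
  have e : (𝓕 (translation (f.toLp 2 volume)) : L2R) =
      (𝓕 (f.compSubConstCLM ℂ (1 : ℝ))).toLp 2 volume := by
    rw [← toLp_compSubConst, SchwartzMap.toLp_fourier_eq]
  dsimp only [Function.comp_apply]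
  rw [e, SchwartzMap.toLp_fourier_eq]
  filter_upwards [(𝓕 f).coeFn_toLp 2 volume,
    (𝓕 (f.compSubConstCLM ℂ (1 : ℝ))).coeFn_toLp 2 volume] with w h1 h2
  rw [h2, fourier_schwartz_compSubConst, id, h1]
  norm_num

theorem fourier_translation_zpow_ae (x : L2R) (k : ℤ) :
    (𝓕 ((translation ^ k) x) : L2R) =ᵐ[volume]
      fun w => Complex.exp (-(2 * π * w * Complex.I) * k) * (𝓕 x : L2R) w := by
  have hadd (l : ℤ) : (𝓕 ((translation ^ (l + 1)) x) : L2R) =ᵐ[volume]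
      fun w => Complex.exp (-(2 * π * w * Complex.I)) * (𝓕 ((translation ^ l) x) : L2R) w := by
    rw [add_comm, translation_zpow_add, zpow_one]
    exact fourier_translation_ae _
  induction k using Int.induction_on with
  | zero => simp
  | succ k ih =>
    filter_upwards [hadd k, ih] with w h1 h2
    rw [h1, h2, ← mul_assoc, ← Complex.exp_add]
    push_cast
    ring_nf
  | pred k ih =>
    have h := hadd (-k - 1)
    rw [sub_add_cancel] at h
    filter_upwards [h, ih] with w h1 h2
    rw [h2] at h1
    rw [← mul_right_inj' (Complex.exp_ne_zero (-(2 * π * w * Complex.I))), ← h1, ← mul_assoc,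
      ← Complex.exp_add]
    push_cast
    ring_nf

end Fourier

/-! ### Essential boundedness of the filters -/

section EssentialBound

/-- The union of the translates of a set by the `N`-torsion points of the circle. -/
def torsionSaturation (N : ℕ) (A : Set (AddCircle (2 * π))) : Set (AddCircle (2 * π)) :=
  {x | ∃ y, N • y = 0 ∧ x + y ∈ A}

variable {N : ℕ} [NeZero N]

theorem torsionSaturation_eq_biUnion (A : Set (AddCircle (2 * π))) :
    torsionSaturation N A = ⋃ l ∈ Finset.range N,
      (fun x => x + ((((l : ℝ) / N * (2 * π) : ℝ)) : AddCircle (2 * π))) ⁻¹' A := by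
  ext x
  simp only [torsionSaturation, Set.mem_ofPred_eq, Set.mem_iUnion, Set.mem_preimage,
    Finset.mem_range, AddCircle.nsmul_eq_zero_iff (NeZero.pos N)]
  constructor
  · rintro ⟨_, ⟨l, hl, rfl⟩, h⟩
    exact ⟨l, hl, h⟩
  · rintro ⟨l, hl, h⟩
    exact ⟨_, ⟨l, hl, rfl⟩, h⟩

theorem measurableSet_torsionSaturation {A : Set (AddCircle (2 * π))} (hA : MeasurableSet A) :
    MeasurableSet (torsionSaturation N A) := by
  rw [torsionSaturation_eq_biUnion]
  exact Finset.measurableSet_biUnion _ fun l _ => measurable_add_const _ hA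

theorem measure_torsionSaturation_le (A : Set (AddCircle (2 * π))) :
    haarAddCircle (torsionSaturation N A) ≤ N * haarAddCircle A := by
  rw [torsionSaturation_eq_biUnion]
  refine (measure_biUnion_finset_le _ _).trans ?_
  simp [measure_preimage_add_right]

/-- A saturated measurable set is the preimage of a measurable set under `t ↦ N t`. -/
theorem exists_preimage_nsmul_eq_torsionSaturation {A : Set (AddCircle (2 * π))}
    (hA : MeasurableSet A) :
    ∃ C, MeasurableSet C ∧
      (fun t : AddCircle (2 * π) => N • t) ⁻¹' C = torsionSaturation N A := by
  -- A measurable section of t ↦ N t: divide the representative in (0, 2π] by N. Since `s (N • x) -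
  -- x` is N-torsion, a saturated set contains `x` exactly when it contains `s (N • x)`.
  let s : AddCircle (2 * π) → AddCircle (2 * π) := fun t =>
    (((measurableEquivIoc (2 * π) 0 t : ℝ) / N : ℝ) : AddCircle (2 * π))
  have hs : Measurable s := AddCircle.measurable_mk'.comp
    ((measurable_subtype_coe.comp (measurableEquivIoc (2 * π) 0).measurable).div_const _)
  have hsN (t : AddCircle (2 * π)) : N • s t = t := by
    have hN : (N : ℝ) ≠ 0 := Nat.cast_ne_zero.2 (NeZero.ne N)
    have h1 : N • s t = ((measurableEquivIoc (2 * π) 0 t : ℝ) : AddCircle (2 * π)) := by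
      rw [← AddCircle.coe_nsmul, nsmul_eq_mul, mul_div_cancel₀ _ hN]
    rw [h1]
    exact (AddCircle.equivIoc (2 * π) 0).symm_apply_apply t
  refine ⟨s ⁻¹' torsionSaturation N A, hs (measurableSet_torsionSaturation hA), ?_⟩
  ext x
  have hd : N • (s (N • x) - x) = 0 := by rw [smul_sub, hsN, sub_self]
  constructor
  · rintro ⟨y, hy, h⟩
    refine ⟨(s (N • x) - x) + y, by rw [smul_add, hd, hy, add_zero], ?_⟩
    rwa [← add_assoc, add_sub_cancel]
  · rintro ⟨y, hy, h⟩
    refine ⟨-(s (N • x) - x) + y, by rw [smul_add, smul_neg, hd, hy, neg_zero, add_zero], ?_⟩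
    change s (N • x) + _ ∈ A
    convert h using 1
    abel

variable {m : L2T} {A : L2T →ₗᵢ[ℂ] L2T}

/-- The isometry is applied to the indicator function of `C`. -/
theorem setLIntegral_preimage_nsmul_of_isometry
    (hA : ∀ f, A f =ᵐ[haarAddCircle] fun t => m t * f (N • t)) {C : Set (AddCircle (2 * π))}
    (hC : MeasurableSet C) :
    ∫⁻ t in (fun t : AddCircle (2 * π) => N • t) ⁻¹' C, ‖m t‖ₑ ^ (2 : ℝ) ∂haarAddCircle =
      haarAddCircle C := by
  have hsq (f : L2T) : ∫⁻ t, ‖f t‖ₑ ^ (2 : ℝ) ∂haarAddCircle = ‖f‖ₑ ^ (2 : ℝ) := by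
    rw [Lp.enorm_def, eLpNorm_eq_lintegral_rpow_enorm_toReal (by simp) (by simp)]
    rw [← ENNReal.rpow_mul]
    simp
  have hNC := (measurePreserving_nsmul N).measurable hC
  set f : L2T := indicatorConstLp 2 hC (measure_ne_top _ _) (1 : ℂ) with hf
  have hfae := indicatorConstLp_coeFn (μ := haarAddCircle) (p := 2) (hs := hC)
    (hμs := measure_ne_top _ _) (c := (1 : ℂ))
  have h1 := hsq (A f)
  rw [LinearIsometry.enorm_map, ← hsq f] at h1
  rw [← lintegral_indicator hNC]
  refine (Eq.trans ?_ h1).trans ?_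
  · refine lintegral_congr_ae ?_
    filter_upwards [hA f, (measurePreserving_nsmul N).quasiMeasurePreserving.ae hfae]
      with t h2 h3
    rw [h2, h3]
    by_cases ht : N • t ∈ C <;> simp [Set.indicator, ht]
  · rw [← lintegral_indicator_one hC]
    refine lintegral_congr_ae ?_
    filter_upwards [hfae] with t h2
    rw [h2]
    by_cases ht : t ∈ C <;> simp [Set.indicator, ht]

/-- If `f ↦ m · f(N ·)` is isometric on `L²(𝕋)`, then `m` is essentially bounded. -/
theorem memLp_top_of_isometry (hA : ∀ f, A f =ᵐ[haarAddCircle] fun t => m t * f (N • t)) :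
    MemLp m ∞ haarAddCircle := by
  -- Any threshold above N would do: saturating `D` multiplies its measure by at most N, while the
  -- integral of |m|² over the saturation equals the measure of the saturation.
  set D : Set (AddCircle (2 * π)) := {t | ((N + 1 : ℕ) : ℝ≥0∞) ≤ ‖m t‖ₑ ^ (2 : ℝ)} with hD
  have hmeas : Measurable fun t => ‖m t‖ₑ ^ (2 : ℝ) :=
    (Lp.stronglyMeasurable m).enorm.pow_const _
  have hDm : MeasurableSet D := measurableSet_le measurable_const hmeas
  obtain ⟨C, hC, hCB⟩ := exists_preimage_nsmul_eq_torsionSaturation (N := N) hDm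
  have hsub : D ⊆ torsionSaturation N D := fun x hx => ⟨0, smul_zero _, by rwa [add_zero]⟩
  have h1 : ((N + 1 : ℕ) : ℝ≥0∞) * haarAddCircle D ≤ N * haarAddCircle D := by
    calc ((N + 1 : ℕ) : ℝ≥0∞) * haarAddCircle D
        = ∫⁻ _ in D, ((N + 1 : ℕ) : ℝ≥0∞) ∂haarAddCircle := by rw [setLIntegral_const]
      _ ≤ ∫⁻ t in D, ‖m t‖ₑ ^ (2 : ℝ) ∂haarAddCircle := setLIntegral_mono hmeas fun t ht => ht
      _ ≤ ∫⁻ t in torsionSaturation N D, ‖m t‖ₑ ^ (2 : ℝ) ∂haarAddCircle :=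
        lintegral_mono_set hsub
      _ = haarAddCircle C := by rw [← hCB, setLIntegral_preimage_nsmul_of_isometry hA hC]
      _ = haarAddCircle (torsionSaturation N D) := by
        rw [← hCB, (measurePreserving_nsmul N).measure_preimage hC.nullMeasurableSet]
      _ ≤ N * haarAddCircle D := measure_torsionSaturation_le D
  have h0 : haarAddCircle D = 0 := by
    have hfin : (N : ℝ≥0∞) * haarAddCircle D ≠ ∞ :=
      ENNReal.mul_ne_top (ENNReal.natCast_ne_top N) (measure_ne_top _ _)
    push_cast at h1
    rw [add_mul, one_mul] at h1
    have := (ENNReal.add_le_add_iff_left hfin).1 (h1.trans_eq (add_zero _).symm)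
    simpa using this
  refine memLp_top_of_bound (Lp.aestronglyMeasurable m) (N + 1 : ℕ) ?_
  filter_upwards [measure_eq_zero_iff_ae_notMem.1 h0] with t ht
  simp only [hD, Set.mem_ofPred_eq, not_le] at ht
  -- The same constant bounds |m| itself, since |m| ≤ |m|² once |m| ≥ 1.
  by_contra! hlt
  refine absurd ht (not_lt.2 ?_)
  have h2 : ((N + 1 : ℕ) : ℝ≥0∞) ≤ ‖m t‖ₑ := by
    rw [← ofReal_norm, ← ENNReal.ofReal_natCast]
    exact ENNReal.ofReal_le_ofReal hlt.le
  have h3 : (1 : ℝ≥0∞) ≤ ((N + 1 : ℕ) : ℝ≥0∞) := by exact_mod_cast Nat.succ_pos N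
  calc ((N + 1 : ℕ) : ℝ≥0∞) ≤ ‖m t‖ₑ ^ (1 : ℝ) := by rwa [ENNReal.rpow_one]
    _ ≤ ‖m t‖ₑ ^ (2 : ℝ) := ENNReal.rpow_le_rpow_of_exponent_le (h3.trans h2) (by norm_num)

end EssentialBound

theorem fourier_nsmul (n : ℤ) (N : ℕ) (t : AddCircle (2 * π)) :
    fourier n (N • t) = fourier (N * n) t := by
  have e : n • (N • t) = (N * n : ℤ) • t := by
    rw [mul_comm (N : ℤ) n, mul_smul, natCast_zsmul]
  simp only [fourier_apply, e]

/-! ### The model of 𝒱₀ on the circle and the intertwining relations -/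

section FatherIsometry

variable {N : ℕ} [NeZero N] {φ η : L2R}

theorem orthonormal_translation_neg (h : Orthonormal ℂ fun k : ℤ => (translation ^ k) φ) :
    Orthonormal ℂ fun n : ℤ => (translation ^ (-n)) φ :=
  h.comp _ neg_injective

/-- The isometry `L²(𝕋) → L²(ℝ)` with range `𝒱₀` that sends `e^{-ikt}` to `T^k φ`. -/
def synthesis (h : Orthonormal ℂ fun k : ℤ => (translation ^ k) φ) : L2T →ₗᵢ[ℂ] L2R :=
  fourierExtend (orthonormal_translation_neg h)

variable (h : Orthonormal ℂ fun k : ℤ => (translation ^ k) φ)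

@[simp]
theorem synthesis_fourierLp (n : ℤ) : synthesis h (fourierLp 2 n) = (translation ^ (-n)) φ :=
  fourierExtend_fourierLp _ n

theorem exists_synthesis_eq {x : L2R} (hx : x ∈ V0 φ) : ∃ f, synthesis h f = x := by
  refine mem_range_fourierExtend _ ?_
  have : (Set.range fun n : ℤ => (translation ^ (-n)) φ) =
      Set.range fun k : ℤ => (translation ^ k) φ :=
    (Equiv.neg ℤ).surjective.range_comp fun k : ℤ => (translation ^ k) φ
  rw [this]
  exact hx

theorem fourier_synthesis_ae (f : L2T) :
    (𝓕 (synthesis h f) : L2R) =ᵐ[volume]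
      fun w => (𝓕 φ : L2R) w * f ((2 * π * w : ℝ) : AddCircle (2 * π)) := by
  have hq : Measure.QuasiMeasurePreserving
      (fun w : ℝ => ((2 * π * w : ℝ) : AddCircle (2 * π))) volume haarAddCircle := by
    have h1 := measurePreserving_div (inv_pos.2 Real.two_pi_pos)
    have h2 : Measure.QuasiMeasurePreserving (fun w : ℝ => w / (2 * π)⁻¹) volume volume :=
      ⟨h1.measurable, h1.map_eq ▸ Measure.smul_absolutelyContinuous⟩
    have h3 := quasiMeasurePreserving_coe_addCircle.comp h2
    convert h3 using 2 with w
    simp only [Function.comp_apply, div_inv_eq_mul, mul_comm]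
  refine ae_eq_mul_comp_of_fourierLp
    ((Lp.fourierTransformₗᵢ ℝ ℂ).toContinuousLinearEquiv.toContinuousLinearMap ∘L
    (synthesis h).toContinuousLinearMap) _ hq (fun n => ?_) f
  change (𝓕 (synthesis h (fourierLp 2 n)) : L2R) =ᵐ[volume] _
  rw [synthesis_fourierLp]
  filter_upwards [fourier_translation_zpow_ae φ (-n)] with w h1
  rw [h1, fourier_coe_apply, mul_comm]
  congr 2
  push_cast
  have : (π : ℂ) ≠ 0 := by exact_mod_cast Real.pi_ne_zero
  field_simp

theorem hat_synthesis_ae (f : L2T) :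
    hat (synthesis h f) =ᵐ[volume] fun t => f (t : AddCircle (2 * π)) * hat φ t := by
  filter_upwards [dilate_aux Real.two_pi_pos (fourier_synthesis_ae h f)] with t h1
  rw [hat, hat, h1, mul_div_cancel₀ _ Real.two_pi_pos.ne']
  ring

theorem hat_injective {x y : L2R} (hxy : hat x =ᵐ[volume] hat y) : x = y := by
  apply (Lp.fourierTransformₗᵢ ℝ ℂ).injective
  apply Lp.ext
  filter_upwards [dilate_aux (inv_pos.2 Real.two_pi_pos) hxy] with w h1
  have hc : ((√(2 * π))⁻¹ : ℂ) ≠ 0 := by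
    have := (Real.sqrt_pos.2 Real.two_pi_pos).ne'
    exact inv_ne_zero (by exact_mod_cast this)
  have e : w / (2 * π)⁻¹ / (2 * π) = w := by
    have := Real.pi_ne_zero
    field_simp
  rw [hat, hat, mul_right_inj' hc, e] at h1
  exact h1

theorem hat_ae_eq_iff (x : L2R) (f : L2T) :
    (∀ᵐ t : ℝ, hat x t = f (t : AddCircle (2 * π)) * hat φ t) ↔ synthesis h f = x := by
  constructor
  · intro hx
    exact hat_injective ((hat_synthesis_ae h f).trans (EventuallyEq.symm hx))
  · rintro rfl
    exact hat_synthesis_ae h f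

/-- The series for m_η is the Fourier expansion of the preimage of U_N η, reindexed by k ↦ -k. In
particular the `tsum` is a genuine sum and not a default value. -/
theorem synthesis_filterFn (hη : scaling N η ∈ V0 φ) :
    synthesis h (filterFn N φ η) = scaling N η := by
  obtain ⟨g, hg⟩ := exists_synthesis_eq h hη
  rw [← hg]
  congr 1
  have h1 := (fourierBasis (T := 2 * π)).hasSum_repr g
  have h2 := (Equiv.neg ℤ).hasSum_iff.2 h1
  rw [filterFn, ← h2.tsum_eq]
  refine tsum_congr fun k => ?_
  simp only [Function.comp_apply, Equiv.neg_apply, HilbertBasis.repr_apply_apply, coe_fourierBasis]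
  congr 1
  rw [← (synthesis h).inner_map_map, hg, synthesis_fourierLp, neg_neg]

/-- Multiplication by `e^{-ikt}` on `L²(𝕋)`. -/
def modulation (k : ℤ) : L2T →ₗᵢ[ℂ] L2T :=
  fourierExtend ((orthonormal_fourier (T := 2 * π)).comp (fun n : ℤ => n - k)
    sub_left_injective)

theorem modulation_fourierLp (k n : ℤ) :
    modulation k (fourierLp 2 n) = (fourierLp 2 (n - k) : L2T) :=
  fourierExtend_fourierLp ((orthonormal_fourier (T := 2 * π)).comp (fun n : ℤ => n - k)
    sub_left_injective) n

theorem modulation_ae (k : ℤ) (g : L2T) :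
    modulation k g =ᵐ[haarAddCircle] fun t => fourier (-k) t * g t := by
  refine ae_eq_mul_comp_of_fourierLp (modulation k).toContinuousLinearMap _
    (Measure.QuasiMeasurePreserving.id _) (fun n => ?_) g
  change modulation k (fourierLp 2 n) =ᵐ[haarAddCircle] _
  rw [modulation_fourierLp]
  filter_upwards [fourierLp_ae (n - k)] with t h1
  rw [h1, id, ← fourier_add]
  congr 1
  ring_nf

theorem synthesis_modulation (k : ℤ) (g : L2T) :
    synthesis h (modulation k g) = (translation ^ k) (synthesis h g) := by
  have : (synthesis h).toContinuousLinearMap ∘L (modulation k).toContinuousLinearMap =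
      (translation ^ k).toContinuousLinearEquiv.toContinuousLinearMap ∘L
        (synthesis h).toContinuousLinearMap := by
    refine clm_ext_fourierLp fun n => ?_
    change synthesis h (modulation k (fourierLp 2 n)) =
      (translation ^ k) (synthesis h (fourierLp 2 n))
    rw [modulation_fourierLp, synthesis_fourierLp, synthesis_fourierLp, ← translation_zpow_add]
    congr 2
    ring
  exact congr($this g)

theorem synthesis_modulation_filterFn (hη : scaling N η ∈ V0 φ) (k : ℤ) :
    synthesis h (modulation (N * k) (filterFn N φ η)) = scaling N ((translation ^ k) η) := by
  rw [synthesis_modulation, synthesis_filterFn h hη, scaling_translation_zpow]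

/-- The isometry `f ↦ m_η · f(N ·)`, for `η` with orthonormal translates and `U_N η ∈ 𝒱₀`. -/
theorem exists_isometry_filterFn (h : Orthonormal ℂ fun k : ℤ => (translation ^ k) φ)
    (hη : scaling N η ∈ V0 φ) (hoη : Orthonormal ℂ fun k : ℤ => (translation ^ k) η) :
    ∃ A : L2T →ₗᵢ[ℂ] L2T,
      ∀ f, A f =ᵐ[haarAddCircle] fun t => filterFn N φ η t * f (N • t) := by
  -- Under `synthesis` these functions become U_N T^{-n} η. The isometry is built from their
  -- orthonormality, before multiplication by m_η is known to be bounded.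
  have ho : Orthonormal ℂ fun n : ℤ => modulation (N * (-n)) (filterFn N φ η) := by
    have h1 := (orthonormal_translation_neg hoη).comp_linearIsometry (scaling N).toLinearIsometry
    refine (LinearIsometry.orthonormal_comp_iff (synthesis h)).1 ?_
    convert h1 using 1
    funext n
    exact synthesis_modulation_filterFn h hη (-n)
  refine ⟨fourierExtend ho, ae_eq_mul_comp_of_fourierLp (fourierExtend ho).toContinuousLinearMap _
    (measurePreserving_nsmul N).quasiMeasurePreserving fun n => ?_⟩
  change fourierExtend ho (fourierLp 2 n) =ᵐ[haarAddCircle] _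
  rw [fourierExtend_fourierLp]
  filter_upwards [modulation_ae (N * (-n)) (filterFn N φ η)] with t h1
  rw [h1, mul_comm, fourier_nsmul]
  congr 3
  ring

theorem memLp_top_filterFn (h : Orthonormal ℂ fun k : ℤ => (translation ^ k) φ)
    (hη : scaling N η ∈ V0 φ) (hoη : Orthonormal ℂ fun k : ℤ => (translation ^ k) η) :
    MemLp (filterFn N φ η) ∞ haarAddCircle :=
  let ⟨_, hA⟩ := exists_isometry_filterFn h hη hoη
  memLp_top_of_isometry hA

theorem synthesis_cuntzOp_fourierLp (hη : scaling N η ∈ V0 φ)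
    (hm : MemLp (filterFn N φ η) ∞ haarAddCircle) (k : ℤ) :
    synthesis h (cuntzOp N (filterFn N φ η) (fourierLp 2 (-k))) =
      scaling N ((translation ^ k) η) := by
  rw [← synthesis_modulation_filterFn h hη]
  congr 1
  apply Lp.ext
  filter_upwards [cuntzOp_ae N _ hm (fourierLp 2 (-k)), modulation_ae (N * k) (filterFn N φ η),
    (measurePreserving_nsmul N).quasiMeasurePreserving.ae (fourierLp_ae (-k))] with t h1 h2 h3
  rw [h1, h2, h3, mul_comm, fourier_nsmul]
  congr 3
  ring

theorem synthesis_cuntzOp (hφ : scaling N φ ∈ V0 φ)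
    (hm : MemLp (filterFn N φ φ) ∞ haarAddCircle) (f : L2T) :
    synthesis h (cuntzOp N (filterFn N φ φ) f) = scaling N (synthesis h f) := by
  have : (synthesis h).toContinuousLinearMap ∘L cuntzOp N (filterFn N φ φ) =
      (scaling N).toContinuousLinearEquiv.toContinuousLinearMap ∘L
        (synthesis h).toContinuousLinearMap := by
    refine clm_ext_fourierLp fun n => ?_
    change synthesis h (cuntzOp N (filterFn N φ φ) (fourierLp 2 n)) =
      scaling N (synthesis h (fourierLp 2 n))
    rw [synthesis_fourierLp, ← synthesis_cuntzOp_fourierLp h hφ hm, neg_neg]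
  exact congr($this f)

theorem synthesis_cuntzOp_pow (hφ : scaling N φ ∈ V0 φ)
    (hm : MemLp (filterFn N φ φ) ∞ haarAddCircle) (n : ℕ) (f : L2T) :
    synthesis h ((cuntzOp N (filterFn N φ φ) ^ n) f) = (scaling N ^ (n : ℤ)) (synthesis h f) := by
  induction n with
  | zero => simp
  | succ n ih =>
    rw [pow_succ', mul_apply_eq_comp, synthesis_cuntzOp h hφ hm, ih, Nat.cast_succ,
      add_comm, scaling_zpow_add, zpow_one]

end FatherIsometry

/-- The sign comes from z = e^{-it}: the character z^k is the monomial with index -k. -/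
theorem circleCoeff_eq_inner (g : L2T) (k : ℤ) :
    circleCoeff g k = ⟪(fourierLp 2 (-k) : L2T), g⟫_ℂ := by
  have h1 := (fourierBasis (T := 2 * π)).repr_apply_apply g (-k)
  rw [coe_fourierBasis] at h1
  rw [← h1, fourierBasis_repr, fourierCoeff_eq_intervalIntegral _ _ (-π), circleCoeff,
    show -π + 2 * π = π by ring, Complex.real_smul]
  congr 1
  · push_cast; rfl
  · refine intervalIntegral.integral_congr fun t _ => ?_
    rw [neg_neg, fourier_coe_apply, smul_eq_mul]
    congr 2
    push_cast
    have : (π : ℂ) ≠ 0 := by exact_mod_cast Real.pi_ne_zero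
    field_simp

end ScaleWavelet

end



theorem corollary8p4 (N : ℕ) [NeZero N] (hN : 2 ≤ N) (φ : L2R) (hφ : IsFather N φ)
    (ψ : Fin (N - 1) → L2R) (hψ : IsMother N φ ψ) :
    -- the orthonormal decomposition of every element of `L²(ℝ)`
    Orthonormal ℂ (wavelet N ψ) ∧
    (∀ ξ : L2R, HasSum (fun p : Fin (N - 1) × ℤ × ℤ =>
      waveletCoeff N ψ ξ p.1 p.2.1 p.2.2 • wavelet N ψ p) ξ) ∧
    -- `𝒱₀` in terms of the coefficients
    (∀ ξ : L2R, ξ ∈ V0 φ ↔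
      ∀ (i : Fin (N - 1)) (j k : ℤ), j ≤ 0 → waveletCoeff N ψ ξ i j k = 0) ∧
    -- the filters are essentially bounded, so that the operators `S_i` are given by
    -- `(S_i f)(t) = m_i(t) f(N t)`
    MemLp (filterFn N φ φ) ∞ haarAddCircle ∧
    (∀ i : Fin (N - 1), MemLp (filterFn N φ (ψ i)) ∞ haarAddCircle) ∧
    -- the representation of the coefficients
    ∀ ξ ∈ V0 φ,
      (∃! f : L2T, ∀ᵐ t : ℝ, hat ξ t = f (t : AddCircle (2 * π)) * hat φ t) ∧
      ∀ f : L2T, (∀ᵐ t : ℝ, hat ξ t = f (t : AddCircle (2 * π)) * hat φ t) →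
        ∀ (i : Fin (N - 1)) (j : ℕ) (k : ℤ), 1 ≤ j →
          waveletCoeff N ψ ξ i j k =
            circleCoeff (ContinuousLinearMap.adjoint (cuntzOp N (filterFn N φ (ψ i)))
              ((ContinuousLinearMap.adjoint (cuntzOp N (filterFn N φ φ)) ^ (j - 1)) f)) k := by
  have hφo := hφ.orthonormal
  have hψo (i : Fin (N - 1)) : Orthonormal ℂ fun k : ℤ => (translation ^ k) (ψ i) :=
    hψ.orthonormal.comp (fun k : ℤ => (i, k)) (Prod.mk_right_injective i)
  have hψV (i : Fin (N - 1)) : scaling N (ψ i) ∈ V0 φ := by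
    simpa [mem_V] using (translation_zpow_mother_mem hψ i 0).2
  have hm₀ := memLp_top_filterFn hφo hφ.scaling_mem hφo
  have hm (i : Fin (N - 1)) := memLp_top_filterFn hφo (hψV i) (hψo i)
  refine ⟨orthonormal_wavelet hφ hψ, hasSum_wavelet hφ hψ, mem_V0_iff hφ hψ, hm₀, hm,
    fun ξ hξ => ⟨?_, ?_⟩⟩
  · obtain ⟨f, hf⟩ := exists_synthesis_eq hφo hξ
    refine ⟨f, (hat_ae_eq_iff hφo ξ f).2 hf, fun g hg => (synthesis hφo).injective ?_⟩
    rw [hf, (hat_ae_eq_iff hφo ξ g).1 hg]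
  · intro f hf i j k hj
    obtain ⟨n, rfl⟩ := Nat.exists_eq_add_of_le' hj
    -- One of the n + 1 scalings turns T^k ψ_i into an element of 𝒱₀, represented by S_i e^{-ikt};
    -- the other n act as S₀.
    have hw : wavelet N ψ (i, ((n + 1 : ℕ) : ℤ), k) =
        synthesis hφo ((cuntzOp N (filterFn N φ φ) ^ n)
          (cuntzOp N (filterFn N φ (ψ i)) (fourierLp 2 (-k)))) := by
      rw [synthesis_cuntzOp_pow hφo hφ.scaling_mem hm₀,
        synthesis_cuntzOp_fourierLp hφo (hψV i) (hm i), wavelet, Nat.cast_succ, scaling_zpow_add,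
        zpow_one]
    -- The isometry is removed from the inner product, and (S₀^*)^n is rewritten as (S₀^n)^* through
    -- `star_pow`, so that both adjoints can be moved across.
    rw [waveletCoeff, hw, ← (hat_ae_eq_iff hφo ξ f).1 hf, LinearIsometry.inner_map_map,
      circleCoeff_eq_inner, ContinuousLinearMap.adjoint_inner_right, Nat.add_sub_cancel,
      ← ContinuousLinearMap.star_eq_adjoint (cuntzOp N (filterFn N φ φ)), ← star_pow,
      ContinuousLinearMap.star_eq_adjoint, ContinuousLinearMap.adjoint_inner_right]
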